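/- **Theorem 2.** Let $G$ be a causal diagram, i.e. a finite directed acyclic graph whose nodes are random variables with finitely many states, and consider a causal model on $G$: a conditional probability table $P(v_i\mid pa_i)$ for each variable $V_i$ given its parents. Let $P(v)=\prod_i P(v_i\mid pa_i)$ be the resulting observational distribution (compatible with $G$), and let $$P(y\mid do(x))=\sum_{v:\,v_X=x,\,v_Y=y}\ \prod_{i:\,V_i\neq X}P(v_i\mid pa_i)$$ be the causal effect given by truncated factorization. A path (a sequence of distinct nodes, consecutive ones joined by an arrow in either direction) is *blocked* by a set of nodes $Z$ if it contains a chain $A\to B\to C$ or a fork $A\leftarrow B\to C$ with $B\in Z$, or a collider $A\to B\leftarrow C$ such that neither $B$ nor any descendant of $B$ is in $Z$. A *back-door path* from a set of nodes $A$ to a set of nodes $B$ is a path that starts at a node of $A$ with an arrow into that node, ends at a node of $B$, and contains no further node of $A$ and no earlier node of $B$. For distinct nodes $X,Y$, a set $Z$ of nodes with $X,Y\notin Z$ satisfies the *front-door criterion* relative to $(X,Y)$ if (i) every directed path from $X$ to $Y$ contains a node of $Z$; (ii) there is no unblocked back-door path from $X$ to $Z$ (each such path is blocked by $\emptyset$);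 (iii) every back-door path from $Z$ to $Y$ is blocked by $\{X\}$. Let $W,U$ be disjoint sets of variables such that $W\cup U$ satisfies the front-door criterion relative to $(X,Y)$, and suppose $P(x,w,u)>0$ for all states $x$ of $X$, $w$ of $W$ and $u$ of $U$. Suppose that only $P(X,Y,W)$ and $P(U)$ are given. Then for every state $x$ of $X$ and $y$ of $Y$, $$LB\le P(y\mid do(x))\le UB,$$ where $LB$ and $UB$ are the optimal values (infimum and supremum, i.e. minimum and maximum whenever these are attained) of $$\sum_{w,u}\frac{b_{x,w,u}}{P(x)}\sum_{x'}\frac{a_{x',w,u}\,P(x')}{b_{x',w,u}}$$ over all real arrays $a=(a_{x',w,u})$, $b=(b_{x',w,u})$ for which the objective is defined (all $b_{x',w,u}\neq 0$) and which satisfy, for all states $x'$ of $X$ and $w$ of $W$, $$\sum_u a_{x',w,u}=P(x',y,w),\qquad \sum_u b_{x',w,u}=P(x',w),$$ and, for all states $x'$, $w$, $u$, $$b_{x',w,u}\ge a_{x',w,u},$$ $$\max\{0,P(x',y,w)+P(u)-1\}\le a_{x',w,u}\le\min\{P(x',y,w),P(u)\},$$ $$\max\{0,P(x',w)+P(u)-1\}\le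 b_{x',w,u}\le\min\{P(x',w),P(u)\}.$$ Moreover, the set of objective values over this region is nonempty and bounded, so that $LB$ and $UB$ are finite. -/

import Mathlib

/-! ### Causal diagrams, paths and blocking -/

/-- A causal diagram: a directed acyclic graph on the set `V` of variables.
`G.Edge a b` means that there is an arrow from `a` to `b`. -/
structure CausalDiagram (V : Type*) where
  Edge : V → V → Prop
  acyclic : ∀ v, ¬ Relation.TransGen Edge v v

namespace CausalDiagram

variable {V : Type*}

/-- `d` is a descendant of `b`. -/
def Descendant (G : CausalDiagram V) (b d : V) : Prop :=
  Relation.TransGen G.Edge b d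

/-- A directed path from `s` to `t`: every consecutive pair is joined by a forward arrow. -/
def IsDirectedPath (G : CausalDiagram V) (s t : V) (p : List V) : Prop :=
  p.head? = some s ∧ p.getLast? = some t ∧ p.IsChain G.Edge

/-- A path: a sequence of distinct nodes, consecutive ones joined by an arrow in either direction.
(The direction of each arrow is determined by the nodes, since `G` is acyclic.) -/
def IsPath (G : CausalDiagram V) (p : List V) : Prop :=
  p.Nodup ∧ p.IsChain (fun a b => G.Edge a b ∨ G.Edge b a)

/-- The path `p` is blocked by `Z`: it contains a chain or a fork whose middle node is in `Z`,
or a collider which is not in `Z` and has no descendant in `Z`. -/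
def Blocked (G : CausalDiagram V) (Z : Set V) (p : List V) : Prop :=
  ∃ a b c : V, [a, b, c] <:+: p ∧
    ((((G.Edge a b ∧ G.Edge b c) ∨ (G.Edge c b ∧ G.Edge b a) ∨ (G.Edge b a ∧ G.Edge b c)) ∧
        b ∈ Z) ∨
      ((G.Edge a b ∧ G.Edge c b) ∧ b ∉ Z ∧ ∀ d ∈ Z, ¬ G.Descendant b d))

/-- A back-door path from the set `A` to the set `B`: a path that starts in `A` with an arrow into
its first node, ends in `B`, and meets `A` only in its first and `B` only in its last node. -/
def IsBackDoorPath (G : CausalDiagram V) (A B : Set V) (p : List V) : Prop :=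
  G.IsPath p ∧
    (∃ s c l, p = s :: c :: l ∧ G.Edge c s ∧ s ∈ A ∧ ∀ v ∈ c :: l, v ∉ A) ∧
    (∃ l t, p = l ++ [t] ∧ t ∈ B ∧ ∀ v ∈ l, v ∉ B)

/-- The front-door criterion for the set `Z` relative to the ordered pair `(X, Y)`. -/
structure FrontDoor (G : CausalDiagram V) (X Y : V) (Z : Set V) : Prop where
  ne : X ≠ Y
  left_notMem : X ∉ Z
  right_notMem : Y ∉ Z
  /-- `Z` intercepts all directed paths from `X` to `Y`. -/
  intercepts : ∀ p, G.IsDirectedPath X Y p → ∃ z ∈ Z, z ∈ p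
  /-- There is no unblocked back-door path from `X` to `Z`. -/
  no_backDoor : ∀ p, G.IsBackDoorPath {X} Z p → G.Blocked ∅ p
  /-- All back-door paths from `Z` to `Y` are blocked by `X`. -/
  backDoor_blocked : ∀ p, G.IsBackDoorPath Z {Y} p → G.Blocked {X} p

end CausalDiagram

/-! ### Causal models, observational distribution and interventions -/

/-- A causal model with diagram `G` and finite state spaces `S v`: for each variable a conditional
probability table given the states of its parents. -/
structure CausalModel {V : Type*} (G : CausalDiagram V) (S : V → Type*)
    [∀ v, Fintype (S v)] where
  cpt : ∀ v, ((u : {u // G.Edge u v}) → S u) → S v → ℝ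
  cpt_nonneg : ∀ v q s, 0 ≤ cpt v q s
  cpt_sum : ∀ v q, ∑ s, cpt v q s = 1

namespace CausalModel

variable {V : Type*} [Fintype V] [DecidableEq V] {G : CausalDiagram V} {S : V → Type*}
  [∀ v, Fintype (S v)] [∀ v, DecidableEq (S v)]

/-- The factor `P(ω_v | pa_v)` of the full assignment `ω`. -/
def factor (M : CausalModel G S) (ω : ∀ v, S v) (v : V) : ℝ :=
  M.cpt v (fun u => ω u) (ω v)

/-- The observational joint distribution: the distribution compatible with `G` with the given
conditional probability tables. -/
def joint (M : CausalModel G S) (ω : ∀ v, S v) : ℝ :=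
  ∏ v, M.factor ω v

/-- The joint distribution under the intervention `do(X = x)`: truncated factorization. -/
def doJoint (M : CausalModel G S) (X : V) (x : S X) (ω : ∀ v, S v) : ℝ :=
  if ω X = x then ∏ v ∈ Finset.univ.erase X, M.factor ω v else 0

/-- The causal effect `P(Y = y | do(X = x))`. -/
def causalEffect (M : CausalModel G S) (X Y : V) (x : S X) (y : S Y) : ℝ :=
  ∑ ω : (∀ v, S v), if ω Y = y then M.doJoint X x ω else 0

/-- The marginal `P(x, y, w)`. -/
def probXYW (M : CausalModel G S) (X Y : V) (W : Finset V)
    (x : S X) (y : S Y) (w : (v : W) → S v) : ℝ :=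
  ∑ ω : (∀ v, S v), if ω X = x ∧ ω Y = y ∧ (fun v : W => ω v) = w then M.joint ω else 0

/-- The marginal `P(u)`. -/
def probU (M : CausalModel G S) (U : Finset V) (u : (v : U) → S v) : ℝ :=
  ∑ ω : (∀ v, S v), if (fun v : U => ω v) = u then M.joint ω else 0

/-- The marginal `P(x, w, u)`. -/
def probXWU (M : CausalModel G S) (X : V) (W U : Finset V)
    (x : S X) (w : (v : W) → S v) (u : (v : U) → S v) : ℝ :=
  ∑ ω : (∀ v, S v),
    if ω X = x ∧ (fun v : W => ω v) = w ∧ (fun v : U => ω v) = u then M.joint ω else 0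

end CausalModel

/-! ### The optimization problem

It depends only on the table `pxyw` of `P(X, Y, W)` and the table `pu` of `P(U)`;
`α`, `β`, `γ`, `δ` are the sets of states of `X`, `Y`, `W`, `U`. -/

namespace FrontDoorProblem

variable {α β γ δ : Type*} [Fintype α] [Fintype β] [Fintype γ] [Fintype δ]

/-- `P(x, w)` -/
def pxw (pxyw : α → β → γ → ℝ) (x : α) (w : γ) : ℝ := ∑ y, pxyw x y w

/-- `P(x)` -/
def px (pxyw : α → β → γ → ℝ) (x : α) : ℝ := ∑ w, pxw pxyw x w

/-- The constraints of the optimization problem for the outcome `y`. -/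
structure Feasible (pxyw : α → β → γ → ℝ) (pu : δ → ℝ) (y : β) (a b : α → γ → δ → ℝ) :
    Prop where
  sum_a : ∀ x w, ∑ u, a x w u = pxyw x y w
  sum_b : ∀ x w, ∑ u, b x w u = pxw pxyw x w
  a_le_b : ∀ x w u, a x w u ≤ b x w u
  le_a : ∀ x w u, max 0 (pxyw x y w + pu u - 1) ≤ a x w u
  a_le : ∀ x w u, a x w u ≤ min (pxyw x y w) (pu u)
  le_b : ∀ x w u, max 0 (pxw pxyw x w + pu u - 1) ≤ b x w u
  b_le : ∀ x w u, b x w u ≤ min (pxw pxyw x w) (pu u)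

/-- The objective function. -/
noncomputable def objective (pxyw : α → β → γ → ℝ) (x : α) (a b : α → γ → δ → ℝ) : ℝ :=
  ∑ w, ∑ u, b x w u / px pxyw x * ∑ x', a x' w u * px pxyw x' / b x' w u

/-- The values of the objective at the feasible points where it is defined,
that is, where no denominator `b x' w u` vanishes. -/
def values (pxyw : α → β → γ → ℝ) (pu : δ → ℝ) (x : α) (y : β) : Set ℝ :=
  {t | ∃ a b : α → γ → δ → ℝ, Feasible pxyw pu y a b ∧ (∀ x' w u, b x' w u ≠ 0) ∧
    objective pxyw x a b = t}

end FrontDoorProblem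

/-! The true marginals `a = P(x, y, w, u)` and `b = P(x, w, u)` satisfy the constraints, which are
consistency with the given marginals, monotonicity and Fréchet bounds, and at them the objective is
the front-door formula for `Z = W ∪ U`. So the causal effect is one of the values of the problem.
These values are bounded because `0 ≤ a / b ≤ 1` and `0 ≤ b ≤ P(x, w)`.

The front-door formula is proved by variable elimination. Let `D` consist of the nodes with a
directed path to `Z` that avoids `X`, and `E` of the ancestors of `X` and the nodes with a directed
path to `Y` that avoids `Z` and `X`. If `D` and `E` had a common node, then a lowest one would be
the source of two disjoint directed paths, which together form an unblocked back-door path: from `X`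
to `Z`, or from `Z` to `Y`. So `D` and `E` are disjoint; moreover, no arrow runs from `X` into `E`,
since `G` is acyclic and `Z` intercepts all directed paths from `X` to `Y`. Hence, once the barren
nodes are removed, `P(x, z)` and `P(x, y, z)` have a common factor, a sum over `D \ Z`, and the
other factors are `P(x)` and a sum over `E`. So the common factor is `P(z | x)` and cancels in
`P(y | x, z)`, whose average over `x` is the sum over `E` that remains after the intervention.
-/

namespace CausalDiagram

section Treks

variable {V : Type*} (G : CausalDiagram V)

instance isStrictOrder_descendant : IsStrictOrder V G.Descendant where
  irrefl := G.acyclic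
  trans _ _ _ := Relation.TransGen.trans

variable {G}

lemma pairwise_transGen_of_isChain {r : V → V → Prop} {l : List V} (h : l.IsChain r) :
    l.Pairwise (Relation.TransGen r) :=
  List.isChain_iff_pairwise.1 (h.imp fun _ _ => .single)

lemma nodup_of_isChain {l : List V} (h : l.IsChain G.Edge) : l.Nodup :=
  have hl : l.Pairwise G.Descendant := pairwise_transGen_of_isChain h
  hl.nodup

/-- The trek with source `v` and legs `v :: p` and `v :: q`: the list that runs backwards along the
first leg, up to `v`, and then forwards along the second. -/
def trek (v : V) (p q : List V) : List V := p.reverse ++ v :: q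

lemma isPath_trek {v : V} {p q : List V} (hp : (v :: p).IsChain G.Edge)
    (hq : (v :: q).IsChain G.Edge) (hpq : p.Disjoint q) : G.IsPath (trek v p q) := by
  obtain ⟨hvp, hpn⟩ := List.nodup_cons.1 (nodup_of_isChain hp)
  refine ⟨List.nodup_append'.2 ⟨List.nodup_reverse.2 hpn, nodup_of_isChain hq, ?_⟩, ?_⟩
  · rw [List.disjoint_reverse_left, List.disjoint_cons_right]
    exact ⟨hvp, hpq⟩
  · have hback : (p.reverse ++ [v]).IsChain fun a b => G.Edge a b ∨ G.Edge b a := by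
      rw [← List.reverse_cons, List.isChain_reverse]
      exact hp.imp fun _ _ => .inr
    simpa [trek] using hback.append_overlap (hq.imp fun _ _ => .inl) (by simp)

/-- The list `m` has no collider `a → b ← c`, so that only a chain or a fork can block it. -/
def NoCollider (G : CausalDiagram V) (m : List V) : Prop :=
  ∀ a b c, [a, b, c] <:+: m → ¬ (G.Edge a b ∧ G.Edge c b)

lemma noCollider_of_isChain {m : List V} (hm : m.IsChain G.Edge) : G.NoCollider m := by
  rintro a b c habc ⟨-, hcb⟩
  have hbc : G.Edge b c := by simpa using (List.isChain_cons_cons.1 (hm.infix habc)).2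
  exact asymm (r := G.Descendant) (.single hbc) (.single hcb)

lemma NoCollider.cons {d v : V} {m : List V} (hm : G.NoCollider (v :: m)) (hvd : G.Edge v d) :
    G.NoCollider (d :: v :: m) := by
  rintro a b c habc hcol
  rcases List.infix_cons_iff.1 habc with hpre | hinf
  · obtain ⟨rfl, rfl, -⟩ : a = d ∧ b = v ∧ [c] <+: m := by
      simpa only [List.cons_prefix_cons] using hpre
    exact asymm (r := G.Descendant) (.single hvd) (.single hcol.1)
  · exact hm a b c hinf hcol

lemma NoCollider.reverse_append {v : V} {p m : List V} (hm : G.NoCollider (v :: m))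
    (hp : (v :: p).IsChain G.Edge) : G.NoCollider (p.reverse ++ v :: m) := by
  induction p generalizing v m with
  | nil => exact hm
  | cons d p ih =>
    obtain ⟨hvd, hp⟩ := List.isChain_cons_cons.1 hp
    simpa using ih (hm.cons hvd) hp

lemma not_blocked_trek {v : V} {p q : List V} {C : Set V} (hp : (v :: p).IsChain G.Edge)
    (hq : (v :: q).IsChain G.Edge) (hC : ∀ a ∈ trek v p q, a ∉ C) :
    ¬ G.Blocked C (trek v p q) := by
  rintro ⟨a, b, c, habc, ⟨-, hb⟩ | ⟨hcol, -⟩⟩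
  · exact hC b (habc.subset (by simp)) hb
  · exact (noCollider_of_isChain hq).reverse_append hp a b c habc hcol

lemma isBackDoorPath_trek {v t e : V} {p q l : List V} {A B : Set V}
    (hp : (v :: (p ++ [t])).IsChain G.Edge) (hq : (v :: q).IsChain G.Edge)
    (hl : v :: q = l ++ [e]) (hpq : (p ++ [t]).Disjoint q)
    (htA : t ∈ A) (hpA : ∀ a ∈ v :: p, a ∉ A) (hqA : ∀ a ∈ q, a ∉ A)
    (heB : e ∈ B) (hpB : ∀ a ∈ p ++ [t], a ∉ B) (hlB : ∀ a ∈ l, a ∉ B) :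
    G.IsBackDoorPath A B (trek v (p ++ [t]) q) := by
  refine ⟨isPath_trek hp hq hpq, ?_, (p ++ [t]).reverse ++ l, e, ?_, heB, ?_⟩
  · obtain ⟨c, m, hcm⟩ : ∃ c m, p.reverse ++ [v] = c :: m :=
      List.exists_cons_of_ne_nil (by simp)
    have hct : G.Edge c t := by
      have hrev : ((v :: (p ++ [t])).reverse).IsChain (flip G.Edge) := List.isChain_reverse.2 hp
      rw [List.reverse_cons, List.reverse_concat, List.cons_append, hcm] at hrev
      exact (List.isChain_cons_cons.1 hrev).1
    refine ⟨t, c, m ++ q, ?_, hct, htA, ?_⟩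
    · rw [trek, List.reverse_concat, ← List.cons_append (as := m), ← hcm]; simp
    · rw [← List.cons_append, ← hcm]
      grind
  · rw [trek, hl, List.append_assoc]
  · grind

end Treks

section AvoidingEdge

variable {V : Type*} {G : CausalDiagram V} {A B C D : Set V} {a b v : V}

/-- An arrow whose tail is not in `D`. Chains of such arrows are the directed paths which avoid `D`,
except possibly at their last node. -/
def AvoidingEdge (G : CausalDiagram V) (D : Set V) (a b : V) : Prop := G.Edge a b ∧ a ∉ D

lemma avoidingEdge_le_edge : G.AvoidingEdge D ≤ G.Edge := fun _ _ h => h.1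

lemma notMem_of_transGen_avoidingEdge (h : Relation.TransGen (G.AvoidingEdge D) a b) : a ∉ D := by
  obtain ⟨c, hac, -⟩ := Relation.TransGen.head'_iff.1 h
  exact hac.2

lemma notMem_of_reflTransGen_avoidingEdge (h : Relation.ReflTransGen (G.AvoidingEdge D) a b)
    (hb : b ∉ D) : a ∉ D := by
  rcases Relation.reflTransGen_iff_eq_or_transGen.1 h with rfl | h
  exacts [hb, notMem_of_transGen_avoidingEdge h]

lemma descendant_of_transGen_avoidingEdge (h : Relation.TransGen (G.AvoidingEdge D) a b) :
    G.Descendant a b :=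
  Relation.TransGen.mono avoidingEdge_le_edge _ _ h

lemma Descendant.transGen_avoidingEdge (h : G.Descendant a b) :
    Relation.TransGen (G.AvoidingEdge {b}) a b := by
  induction h using Relation.TransGen.head_induction_on with
  | single hab => exact .single ⟨hab, fun h => G.acyclic b (.single (h ▸ hab))⟩
  | head hac hcb ih => exact .head ⟨hac, fun h => G.acyclic b (.head (h ▸ hac) hcb)⟩ ih

lemma exists_reflTransGen_avoidingEdge_union (hb : b ∈ B)
    (h : Relation.ReflTransGen (G.AvoidingEdge D) a b) :
    ∃ e ∈ B, Relation.ReflTransGen (G.AvoidingEdge (D ∪ B)) a e := by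
  induction h using Relation.ReflTransGen.head_induction_on with
  | refl => exact ⟨b, hb, .refl⟩
  | @head a c hac _ ih =>
    by_cases ha : a ∈ B
    · exact ⟨a, ha, .refl⟩
    · obtain ⟨e, he, hce⟩ := ih
      exact ⟨e, he, .head ⟨hac.1, by simp [hac.2, ha]⟩ hce⟩

lemma exists_isChain_of_reflTransGen {r : V → V → Prop} (h : Relation.ReflTransGen r a b) :
    ∃ q l, (a :: q).IsChain r ∧ a :: q = l ++ [b] := by
  obtain ⟨q, hq, hlast⟩ := List.exists_isChain_cons_of_relationReflTransGen h
  exact ⟨q, (a :: q).dropLast, hq, by rw [← hlast, List.dropLast_append_getLast]⟩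

lemma exists_isChain_of_transGen {r : V → V → Prop} (h : Relation.TransGen r a b) :
    ∃ p, (a :: (p ++ [b])).IsChain r := by
  obtain ⟨c, hac, hcb⟩ := Relation.TransGen.head'_iff.1 h
  obtain ⟨q, l, hq, hl⟩ := exists_isChain_of_reflTransGen hcb
  exact ⟨l, hl ▸ List.isChain_cons_cons.2 ⟨hac, hq⟩⟩

lemma transGen_of_isChain_concat {r : V → V → Prop} {l : List V} (h : (l ++ [b]).IsChain r)
    (ha : a ∈ l) : Relation.TransGen r a b :=
  (List.pairwise_append.1 (pairwise_transGen_of_isChain h)).2.2 a ha b (by simp)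

lemma reflTransGen_of_isChain_concat {r : V → V → Prop} {l : List V} (h : (l ++ [b]).IsChain r)
    (ha : a ∈ l ++ [b]) : Relation.ReflTransGen r a b := by
  rcases List.mem_append.1 ha with ha | ha
  · exact (transGen_of_isChain_concat h ha).to_reflTransGen
  · rw [List.mem_singleton.1 ha]

/-- A source as far down as possible: no inner node of the leg to `A` is a source, too. -/
lemma exists_legs [Finite V] (hvA : ∃ t ∈ A, Relation.TransGen (G.AvoidingEdge D) v t)
    (hvB : ∃ e ∈ B, Relation.ReflTransGen (G.AvoidingEdge D) v e) :
    ∃ v p q l, ∃ t ∈ A, ∃ e ∈ B, (v :: (p ++ [t])).IsChain (G.AvoidingEdge D) ∧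
      (v :: q).IsChain (G.AvoidingEdge D) ∧ v :: q = l ++ [e] ∧ (∀ a ∈ l, a ∉ B) ∧
      ∀ a ∈ p, ∀ b ∈ B, ¬ Relation.ReflTransGen (G.AvoidingEdge D) a b := by
  obtain ⟨v, ⟨⟨t, htA, hvt⟩, e', heB', hve'⟩, hmin⟩ :=
    (Finite.wellFounded_of_trans_of_irrefl (Function.swap G.Descendant)).has_min
      {v | (∃ t ∈ A, Relation.TransGen (G.AvoidingEdge D) v t) ∧
        ∃ e ∈ B, Relation.ReflTransGen (G.AvoidingEdge D) v e} ⟨v, hvA, hvB⟩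
  obtain ⟨e, heB, hve⟩ := exists_reflTransGen_avoidingEdge_union heB' hve'
  obtain ⟨p, hp⟩ := exists_isChain_of_transGen hvt
  obtain ⟨q, l, hq, hl⟩ := exists_isChain_of_reflTransGen hve
  refine ⟨v, p, q, l, t, htA, e, heB, hp, hq.imp fun _ _ h => ⟨h.1, fun h' => h.2 (.inl h')⟩, hl,
    fun a ha haB => ?_, fun a ha b hb hab => hmin a ⟨⟨t, htA, ?_⟩, b, hb, hab⟩ ?_⟩
  · exact notMem_of_transGen_avoidingEdge (transGen_of_isChain_concat (hl ▸ hq) ha) (.inr haB)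
  · exact transGen_of_isChain_concat (l := v :: p) hp (.tail _ ha)
  · exact descendant_of_transGen_avoidingEdge <|
      List.rel_of_pairwise_cons (pairwise_transGen_of_isChain hp) (List.mem_append_left _ ha)

theorem exists_backDoorPath_not_blocked [Finite V] (hAB : Disjoint A B) (hAC : Disjoint A C)
    (hBC : Disjoint B C) (hvA : ∃ t ∈ A, Relation.TransGen (G.AvoidingEdge (A ∪ C)) v t)
    (hvB : ∃ e ∈ B, Relation.ReflTransGen (G.AvoidingEdge (A ∪ C)) v e) :
    ∃ m, G.IsBackDoorPath A B m ∧ ¬ G.Blocked C m := by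
  obtain ⟨v, p, q, l, t, htA, e, heB, hp, hq, hl, hlB, hpB⟩ := exists_legs hvA hvB
  have hqe {a} (ha : a ∈ v :: q) : Relation.ReflTransGen (G.AvoidingEdge (A ∪ C)) a e :=
    reflTransGen_of_isChain_concat (hl ▸ hq) (hl ▸ ha)
  have hqAC {a} (ha : a ∈ v :: q) : a ∉ A ∪ C :=
    notMem_of_reflTransGen_avoidingEdge (hqe ha) <| by
      simp [Set.disjoint_right.1 hAB heB, Set.disjoint_left.1 hBC heB]
  have hpAC {a} (ha : a ∈ v :: p) : a ∉ A ∪ C :=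
    notMem_of_transGen_avoidingEdge (transGen_of_isChain_concat (l := v :: p) hp ha)
  have hp' := hp.imp avoidingEdge_le_edge
  have hq' := hq.imp avoidingEdge_le_edge
  refine ⟨trek v (p ++ [t]) q, isBackDoorPath_trek hp' hq' hl ?_ htA
    (fun a ha haA => hpAC ha (.inl haA)) (fun a ha haA => hqAC (.tail _ ha) (.inl haA)) heB ?_
    hlB, not_blocked_trek hp' hq' ?_⟩
  · refine List.disjoint_left.2 fun a hap haq => ?_
    rcases List.mem_append.1 hap with ha | ha
    · exact hpB a ha e heB (hqe (.tail _ haq))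
    · exact hqAC (.tail _ haq) (.inl (List.mem_singleton.1 ha ▸ htA))
  · intro a ha haB
    rcases List.mem_append.1 ha with ha | ha
    · exact hpB a ha a haB .refl
    · exact Set.disjoint_left.1 hAB (List.mem_singleton.1 ha ▸ htA) haB
  · intro a ha haC
    simp only [trek, List.mem_append, List.mem_reverse] at ha
    rcases ha with (ha | ha) | ha
    · exact hpAC (.tail _ ha) (.inr haC)
    · exact Set.disjoint_left.1 hAC (List.mem_singleton.1 ha ▸ htA) haC
    · exact hqAC ha (.inr haC)

end AvoidingEdge

section FrontDoor

variable {V : Type*} {G : CausalDiagram V} {X Y v z : V} {Z : Set V}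

lemma FrontDoor.outcome_notMem (h : G.FrontDoor X Y Z) : Y ∉ Z ∪ {X} := by
  simp [h.right_notMem, h.ne.symm]

lemma FrontDoor.not_reflTransGen_of_descendant [Finite V] (h : G.FrontDoor X Y Z)
    (hvX : G.Descendant v X) (hz : z ∈ Z) :
    ¬ Relation.ReflTransGen (G.AvoidingEdge {X}) v z := by
  intro hvz
  obtain ⟨m, hm, hblocked⟩ := exists_backDoorPath_not_blocked (A := {X}) (B := Z) (C := ∅)
    (by simpa using h.left_notMem) (by simp) (by simp)
    ⟨X, rfl, by simpa using hvX.transGen_avoidingEdge⟩ ⟨z, hz, by simpa using hvz⟩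
  exact hblocked (h.no_backDoor m hm)

lemma FrontDoor.not_reflTransGen_of_transGen [Finite V] (h : G.FrontDoor X Y Z) (hz : z ∈ Z)
    (hvz : Relation.TransGen (G.AvoidingEdge (Z ∪ {X})) v z) :
    ¬ Relation.ReflTransGen (G.AvoidingEdge (Z ∪ {X})) v Y := by
  intro hvY
  obtain ⟨m, hm, hblocked⟩ := exists_backDoorPath_not_blocked (A := Z) (B := {Y}) (C := {X})
    (by simpa using h.right_notMem) (by simpa using h.left_notMem) (by simpa using h.ne.symm)
    ⟨z, hz, hvz⟩ ⟨Y, rfl, hvY⟩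
  exact hblocked (h.backDoor_blocked m hm)

lemma FrontDoor.not_reflTransGen_of_reflTransGen [Finite V] (h : G.FrontDoor X Y Z)
    (hz : z ∈ Z) (hvz : Relation.ReflTransGen (G.AvoidingEdge {X}) v z) :
    ¬ Relation.ReflTransGen (G.AvoidingEdge (Z ∪ {X})) v Y := by
  intro hvY
  obtain ⟨z', hz', hvz'⟩ := exists_reflTransGen_avoidingEdge_union hz hvz
  rw [Set.union_comm] at hvz'
  rcases Relation.reflTransGen_iff_eq_or_transGen.1 hvz' with rfl | hvz'
  · exact notMem_of_reflTransGen_avoidingEdge hvY h.outcome_notMem (.inl hz')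
  · exact h.not_reflTransGen_of_transGen hz' hvz' hvY

lemma FrontDoor.not_edge (h : G.FrontDoor X Y Z)
    (hvY : Relation.ReflTransGen (G.AvoidingEdge (Z ∪ {X})) v Y) : ¬ G.Edge X v := by
  intro hXv
  obtain ⟨q, l, hq, hl⟩ := exists_isChain_of_reflTransGen hvY
  obtain ⟨z, hz, hzq⟩ := h.intercepts (X :: v :: q)
    ⟨rfl, by simp [hl, List.getLast?_cons],
      List.isChain_cons_cons.2 ⟨hXv, hq.imp avoidingEdge_le_edge⟩⟩
  rcases List.mem_cons.1 hzq with rfl | hzq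
  · exact h.left_notMem hz
  · have hzY := reflTransGen_of_isChain_concat (hl ▸ hq) (hl ▸ hzq)
    exact notMem_of_reflTransGen_avoidingEdge hzY h.outcome_notMem (.inl hz)

end FrontDoor

section FrontDoorSplit

variable {V : Type*} [DecidableEq V] {G : CausalDiagram V} {X Y : V} {Z D E : Finset V}

/-- The part of the front-door criterion which the adjustment formula needs: two disjoint sets `D`
and `E` not containing `X`, with `Z ⊆ D`, such that `D` is closed under parents except for `X`,
and `E` contains the ancestors of `X` and is closed under parents except for those in `Z`. -/
structure FrontDoorSplit (G : CausalDiagram V) (X : V) (Z D E : Finset V) : Prop where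
  subset : Z ⊆ D
  disjoint : Disjoint D E
  notMem_left : X ∉ D
  notMem_right : X ∉ E
  parent_left : ∀ {a b}, G.Edge a b → b ∈ D → a ∈ insert X D
  parent_right : ∀ {a b}, G.Edge a b → b ∈ E → a ∈ E ∪ Z
  ancestor : ∀ {a}, G.Descendant a X → a ∈ E

lemma FrontDoor.exists_frontDoorSplit [Finite V] (h : G.FrontDoor X Y Z) :
    ∃ D E, G.FrontDoorSplit X Z D E ∧ Y ∈ E := by
  classical
  have := Fintype.ofFinite V
  refine ⟨({v | ∃ z ∈ Z, Relation.ReflTransGen (G.AvoidingEdge {X}) v z} : Finset V),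
    ({v | G.Descendant v X ∨ Relation.ReflTransGen (G.AvoidingEdge (Z ∪ {X})) v Y} : Finset V),
    ⟨?_, ?_, ?_, ?_, ?_, ?_, ?_⟩, ?_⟩
  all_goals simp only [Finset.subset_iff, Finset.disjoint_left, Finset.mem_filter_univ,
    Finset.mem_insert, Finset.mem_union]
  · exact fun z hz => ⟨z, hz, .refl⟩
  · rintro v ⟨z, hz, hvz⟩ (hvX | hvY)
    · exact h.not_reflTransGen_of_descendant hvX hz hvz
    · exact h.not_reflTransGen_of_reflTransGen hz hvz hvY
  · rintro ⟨z, hz, hXz⟩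
    exact notMem_of_reflTransGen_avoidingEdge hXz (fun hzX => h.left_notMem (hzX ▸ hz)) rfl
  · rintro (hX | hXY)
    · exact G.acyclic X hX
    · exact notMem_of_reflTransGen_avoidingEdge hXY h.outcome_notMem (.inr rfl)
  · rintro a b hab ⟨z, hz, hbz⟩
    exact or_iff_not_imp_left.2 fun haX => ⟨z, hz, .head ⟨hab, haX⟩ hbz⟩
  · rintro a b hab (hbX | hbY)
    · exact .inl (.inl (.head hab hbX))
    · refine or_iff_not_imp_right.2 fun haZ => .inr (.head ⟨hab, ?_⟩ hbY)
      rintro (ha | rfl)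
      exacts [haZ ha, h.not_edge hbY hab]
  · exact .inl
  · exact .inr .refl

end FrontDoorSplit

end CausalDiagram

section SumOut

variable {V : Type*} {S : V → Type*} {R : Type*} {A B : Finset V} {D : Set V}
  {f g : (∀ v, S v) → R}

lemma dependsOn_mul [Mul R] (hf : DependsOn f D) (hg : DependsOn g D) : DependsOn (f * g) D :=
  fun _ _ h => congrArg₂ (· * ·) (hf h) (hg h)

variable [DecidableEq V] [∀ v, Fintype (S v)]

/-- The function `f` with the coordinates in `A` summed out, used for marginals. As for
`MeasureTheory.lmarginal`, the result is still a function of all the coordinates; it does not depend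
on those in `A`. -/
def sumOut [AddCommMonoid R] (A : Finset V) (f : (∀ v, S v) → R) (ω : ∀ v, S v) : R :=
  ∑ s : ∀ v : A, S v, f (Function.updateFinset ω A s)

lemma sumOut_empty [AddCommMonoid R] (f : (∀ v, S v) → R) : sumOut ∅ f = f := by
  funext ω
  simp [sumOut]

lemma sumOut_singleton [AddCommMonoid R] (a : V) (f : (∀ v, S v) → R) (ω : ∀ v, S v) :
    sumOut {a} f ω = ∑ s, f (Function.update ω a s) := by
  refine Fintype.sum_equiv (Equiv.piUnique fun v : ({a} : Finset V) => S v) _ _ fun s => ?_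
  rw [Function.updateFinset_singleton]
  rfl

lemma sumOut_sumOut [AddCommMonoid R] (hAB : Disjoint A B) (f : (∀ v, S v) → R) :
    sumOut A (sumOut B f) = sumOut (A ∪ B) f := by
  funext ω
  simp only [sumOut, Function.updateFinset_updateFinset hAB]
  rw [← Fintype.sum_prod_type']
  exact (Equiv.piFinsetUnion S hAB).sum_comp fun s => f (Function.updateFinset ω (A ∪ B) s)

lemma dependsOn_sumOut [AddCommMonoid R] (hf : DependsOn f D) (A : Finset V) :
    DependsOn (sumOut A f) (D \ A) :=
  fun _ _ h => Finset.sum_congr rfl fun s _ => hf.updateFinset s h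

lemma sumOut_eq_sum_ite [Fintype V] [∀ v, DecidableEq (S v)] [AddCommMonoid R] (A : Finset V)
    (f : (∀ v, S v) → R) (ω : ∀ v, S v) :
    sumOut A f ω = ∑ σ : ∀ v, S v, if ∀ v ∉ A, σ v = ω v then f σ else 0 := by
  rw [← Finset.sum_filter]
  refine Finset.sum_nbij' (Function.updateFinset ω A) A.restrict ?_ (by simp) ?_ ?_ (by simp)
  · simp +contextual [Function.updateFinset]
  · simp [Function.restrict_updateFinset]
  · intro σ hσ
    ext v
    by_cases hv : v ∈ A
    · simp [Function.updateFinset, hv]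
    · simpa [Function.updateFinset, hv] using ((Finset.mem_filter.1 hσ).2 v hv).symm

lemma sumOut_mul_left [NonUnitalNonAssocSemiring R] (hf : DependsOn f (↑A)ᶜ) (g : (∀ v, S v) → R) :
    sumOut A (f * g) = f * sumOut A g := by
  funext ω
  simp only [sumOut, Pi.mul_apply, Finset.mul_sum]
  refine Finset.sum_congr rfl fun s _ => ?_
  rw [hf (y := ω) fun v hv => by simp_all [Function.updateFinset]]

lemma sumOut_mul_right [NonUnitalCommSemiring R] (hg : DependsOn g (↑A)ᶜ) (f : (∀ v, S v) → R) :
    sumOut A (f * g) = sumOut A f * g := by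
  rw [mul_comm, sumOut_mul_left hg, mul_comm]

lemma sumOut_mul_mul [NonUnitalCommSemiring R] (hAB : Disjoint A B) (hf : DependsOn f (↑B)ᶜ)
    (hg : DependsOn g (↑A)ᶜ) : sumOut (A ∪ B) (f * g) = sumOut A f * sumOut B g := by
  rw [← sumOut_sumOut hAB, sumOut_mul_left hf]
  exact sumOut_mul_right ((dependsOn_sumOut hg B).mono Set.sdiff_subset) f

lemma sumOut_singleton_restrict [AddCommMonoid R] {a : V} (ha : a ∉ A ∪ B)
    (h : S a → (∀ v : A, S v) → (∀ v : B, S v) → R) (ω : ∀ v, S v) :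
    sumOut {a} (fun σ => h (σ a) (A.restrict σ) (B.restrict σ)) ω =
      ∑ s, h s (A.restrict ω) (B.restrict ω) := by
  rw [Finset.mem_union, not_or] at ha
  rw [sumOut_singleton]
  refine Finset.sum_congr rfl fun s _ => ?_
  have hA : A.restrict (Function.update ω a s) = A.restrict ω :=
    funext fun v => Function.update_of_ne (ne_of_mem_of_not_mem v.2 ha.1) _ _
  have hB : B.restrict (Function.update ω a s) = B.restrict ω :=
    funext fun v => Function.update_of_ne (ne_of_mem_of_not_mem v.2 ha.2) _ _
  rw [hA, hB, Function.update_self]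

lemma sumOut_union_restrict [AddCommMonoid R] {a : V} (hAB : Disjoint A B) (ha : a ∉ A ∪ B)
    (h : S a → (∀ v : A, S v) → (∀ v : B, S v) → R) (ω : ∀ v, S v) :
    sumOut (A ∪ B) (fun σ => h (σ a) (A.restrict σ) (B.restrict σ)) ω =
      ∑ s, ∑ t, h (ω a) s t := by
  rw [Finset.mem_union, not_or] at ha
  rw [← sumOut_sumOut hAB]
  refine Finset.sum_congr rfl fun s _ => Finset.sum_congr rfl fun t _ => ?_
  let σ := Function.updateFinset (Function.updateFinset ω A s) B t
  have ha : σ a = ω a := by simp [σ, Function.updateFinset, ha]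
  have hA : A.restrict σ = s := by
    funext v
    simp [σ, Function.updateFinset, Finset.disjoint_left.1 hAB v.2]
  have hB : B.restrict σ = t := Function.restrict_updateFinset _ t
  change h (σ a) (A.restrict σ) (B.restrict σ) = h (ω a) s t
  rw [ha, hA, hB]

end SumOut

namespace CausalModel

section FactorProd

variable {V : Type*} {G : CausalDiagram V} {S : V → Type*} [∀ v, Fintype (S v)]
  (M : CausalModel G S) {A K N : Finset V} {D : Set V}

/-- The product of the factors of the variables in `A`, usually written `Q[A]`. -/
def factorProd (A : Finset V) (ω : ∀ v, S v) : ℝ := ∏ v ∈ A, M.factor ω v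

lemma factor_nonneg (ω : ∀ v, S v) (v : V) : 0 ≤ M.factor ω v := M.cpt_nonneg _ _ _

lemma joint_nonneg [Fintype V] (ω : ∀ v, S v) : 0 ≤ M.joint ω :=
  Finset.prod_nonneg fun v _ => M.factor_nonneg ω v

lemma dependsOn_factorProd (hA : ↑A ⊆ D) (hD : ∀ {a b}, G.Edge a b → b ∈ A → a ∈ D) :
    DependsOn (M.factorProd A) D := by
  intro σ τ h
  refine Finset.prod_congr rfl fun v hv => ?_
  have hpa : (fun u : {u // G.Edge u v} => σ u) = fun u : {u // G.Edge u v} => τ u :=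
    funext fun u => h u (hD u.2 hv)
  simp only [factor, hpa, h v (hA hv)]

include M in
lemma nonempty_state [Finite V] (v : V) : Nonempty (S v) := by
  induction v using (Finite.wellFounded_of_trans_of_irrefl G.Descendant).induction with
  | _ v ih =>
  have q : (u : {u // G.Edge u v}) → S u := fun u => (ih u (.single u.2)).some
  by_contra h
  rw [not_nonempty_iff] at h
  simpa using M.cpt_sum v q

lemma factorProd_univ [Fintype V] : M.factorProd Finset.univ = M.joint := rfl

variable [DecidableEq V]

lemma factorProd_union (h : Disjoint A N) :
    M.factorProd (A ∪ N) = M.factorProd A * M.factorProd N :=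
  funext fun _ => Finset.prod_union h

lemma sumOut_factorProd_singleton (v : V) : sumOut {v} (M.factorProd {v}) = 1 := by
  funext ω
  have hpa (s : S v) : (fun u : {u // G.Edge u v} => Function.update ω v s u) =
      fun u : {u // G.Edge u v} => ω u := by
    refine funext fun ⟨u, huv⟩ => Function.update_of_ne ?_ _ _
    rintro (rfl : u = v)
    exact G.acyclic u (.single huv)
  simp [sumOut_singleton, factorProd, factor, hpa, M.cpt_sum]

lemma sumOut_factorProd (A : Finset V) : sumOut A (M.factorProd A) = 1 := by
  induction A using Finset.strongInduction with
  | H A ih =>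
  obtain rfl | ⟨a, ha⟩ := A.eq_empty_or_nonempty
  · funext ω
    simp [sumOut_empty, factorProd]
  obtain ⟨⟨v, hv⟩, -, hchild⟩ := WellFounded.has_min
    (A.finite_toSet.wellFoundedOn (r := Function.swap G.Descendant)) Set.univ ⟨⟨a, ha⟩, trivial⟩
  have hdisj : Disjoint (A.erase v) {v} := by simp
  have hdep : DependsOn (M.factorProd (A.erase v)) (↑({v} : Finset V))ᶜ := by
    refine M.dependsOn_factorProd (by simp [Set.subset_def]) fun {u b} hub hb => ?_
    simp only [Finset.coe_singleton, Set.mem_compl_singleton_iff]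
    rintro rfl
    exact hchild ⟨b, Finset.mem_of_mem_erase hb⟩ trivial (.single hub)
  have herase : A.erase v ∪ {v} = A := by
    rw [Finset.union_comm, ← Finset.insert_eq, Finset.insert_erase hv]
  calc sumOut A (M.factorProd A)
      = sumOut (A.erase v ∪ {v}) (M.factorProd (A.erase v ∪ {v})) := by rw [herase]
    _ = sumOut (A.erase v) (M.factorProd (A.erase v)) := by
      rw [M.factorProd_union hdisj, ← sumOut_sumOut hdisj, sumOut_mul_left hdep,
        M.sumOut_factorProd_singleton, mul_one]
    _ = 1 := ih _ (Finset.erase_ssubset hv)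

/-- Elimination of the barren nodes `N`. -/
lemma sumOut_mul_factorProd_union {φ : (∀ v, S v) → ℝ} (hKN : Disjoint K N) (hAN : Disjoint A N)
    (hφ : DependsOn φ (↑N)ᶜ) (hN : ∀ {a b}, G.Edge a b → b ∈ A → a ∉ N) :
    sumOut (K ∪ N) (φ * M.factorProd (A ∪ N)) = sumOut K (φ * M.factorProd A) := by
  have hA : DependsOn (M.factorProd A) (↑N)ᶜ :=
    M.dependsOn_factorProd (fun a ha => Finset.disjoint_left.1 hAN ha) hN
  rw [M.factorProd_union hAN, ← sumOut_sumOut hKN, ← mul_assoc,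
    sumOut_mul_left (dependsOn_mul hφ hA), sumOut_factorProd, mul_one]

lemma sum_joint [Fintype V] : ∑ ω : ∀ v, S v, M.joint ω = 1 := by
  classical
  have h := congrFun (M.sumOut_factorProd Finset.univ) fun v => (M.nonempty_state v).some
  simpa [sumOut_eq_sum_ite, factorProd_univ] using h

end FactorProd

section Adjustment

variable {V : Type*} [DecidableEq V] {G : CausalDiagram V} {S : V → Type*} [∀ v, Fintype (S v)]
  (M : CausalModel G S) {X : V} {Z D E : Finset V}

lemma sumOut_sumOut_factorProd_insert (h : G.FrontDoorSplit X Z D E)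
    {φ : (∀ v, S v) → ℝ} (hφ : DependsOn φ ↑E) :
    sumOut {X} (sumOut E (φ * M.factorProd (insert X E))) = sumOut E (φ * M.factorProd E) := by
  have hEX : Disjoint E {X} := by simpa using h.notMem_right
  have hXZ : X ∉ Z := fun hX => h.notMem_left (h.subset hX)
  rw [sumOut_sumOut hEX.symm, Finset.union_comm, Finset.insert_eq, Finset.union_comm {X},
    M.sumOut_mul_factorProd_union hEX hEX]
  · exact hφ.mono fun a ha haX => h.notMem_right (by grind)
  · intro a b hab hb haX
    have := h.parent_right hab hb
    grind [h.notMem_right]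

variable [Fintype V]

lemma sumOut_factorProd_insert (hXE : X ∉ E) (hE : ∀ {a}, G.Descendant a X → a ∈ E) :
    sumOut E (M.factorProd (insert X E)) = sumOut {X}ᶜ M.joint := by
  classical
  let T : Finset V := {a | G.Descendant a X}
  have hancestors {B : Finset V} (hXB : X ∉ B) (hB : T ⊆ B) :
      sumOut B (M.factorProd (insert X B)) = sumOut T (M.factorProd (insert X T)) := by
    have hbarren := M.sumOut_mul_factorProd_union (φ := 1) (K := T) (A := insert X T) (N := B \ T)
      Finset.disjoint_sdiff (by simp [Finset.disjoint_sdiff, hXB]) (fun _ _ _ => rfl) ?_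
    · simpa [Finset.insert_union, Finset.union_sdiff_of_subset hB] using hbarren
    · intro a b hab hb
      have ha : a ∈ T := by
        rw [Finset.mem_filter_univ]
        rcases Finset.mem_insert.1 hb with rfl | hb
        exacts [.single hab, .head hab ((Finset.mem_filter_univ b).1 hb)]
      simp [ha]
  have hXT : T ⊆ {X}ᶜ := fun a ha => by
    simp only [T, Finset.mem_filter_univ] at ha
    simpa using fun h : a = X => G.acyclic X (h ▸ ha)
  rw [hancestors hXE fun a ha => hE (by simpa [T] using ha), ← hancestors (by simp) hXT]
  simp [factorProd_univ]

lemma sumOut_mul_factorProd_compl (h : G.FrontDoorSplit X Z D E) {ψ : (∀ v, S v) → ℝ}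
    (hψ : DependsOn ψ ↑(insert X (E ∪ Z))) :
    sumOut (insert X Z)ᶜ (ψ * M.factorProd (insert X E)ᶜ) =
      sumOut (D \ Z) (M.factorProd D) * sumOut E ψ := by
  obtain ⟨hZD, hDE, hXD, hXE, hD, -, -⟩ := h
  have hdisj {a} (ha : a ∈ D) : a ∉ E := Finset.disjoint_left.1 hDE ha
  let N := (insert X (D ∪ E))ᶜ
  have hcompl : (insert X E)ᶜ = D ∪ N := by grind [Finset.mem_compl]
  have hcompl' : (insert X Z)ᶜ = D \ Z ∪ E ∪ N := by grind [Finset.mem_compl]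
  rw [hcompl, hcompl', M.sumOut_mul_factorProd_union ?_ ?_ ?_ ?_, mul_comm, sumOut_mul_mul ?_ ?_ ?_]
  · exact Finset.disjoint_of_subset_left Finset.sdiff_subset hDE
  · refine M.dependsOn_factorProd (fun a ha => hdisj ha) fun hab hb haE => ?_
    have := hD hab hb
    grind
  · refine hψ.mono fun a ha haDZ => ?_
    simp only [Finset.coe_insert, Finset.coe_union, Set.mem_insert_iff, Set.mem_union,
      Finset.mem_coe, Finset.mem_sdiff] at ha haDZ
    grind
  · grind [Finset.disjoint_left, Finset.mem_compl]
  · grind [Finset.disjoint_left, Finset.mem_compl]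
  · refine hψ.mono fun a ha haN => ?_
    simp only [N, Finset.coe_insert, Finset.coe_union, Set.mem_insert_iff, Set.mem_union,
      Finset.mem_coe, Finset.mem_compl, Finset.mem_insert, Finset.mem_union] at ha haN
    grind
  · intro a b hab hb
    have := hD hab hb
    grind [Finset.mem_compl]

lemma factorProd_mul_factorProd_compl (A : Finset V) :
    M.factorProd A * M.factorProd Aᶜ = M.joint := by
  rw [← M.factorProd_union disjoint_compl_right, Finset.union_compl, factorProd_univ]

lemma sumOut_mul_joint (h : G.FrontDoorSplit X Z D E) {φ : (∀ v, S v) → ℝ}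
    (hφ : DependsOn φ ↑E) :
    sumOut (insert X Z)ᶜ (φ * M.joint) =
      sumOut (D \ Z) (M.factorProd D) * sumOut E (φ * M.factorProd (insert X E)) := by
  have hQ : DependsOn (M.factorProd (insert X E)) ↑(insert X (E ∪ Z)) := by
    refine M.dependsOn_factorProd (by grind) fun {a b} hab hb => ?_
    rcases Finset.mem_insert.1 hb with rfl | hb
    · simp [h.ancestor (.single hab)]
    · exact Finset.mem_insert_of_mem (h.parent_right hab hb)
  rw [← M.factorProd_mul_factorProd_compl (insert X E), ← mul_assoc,
    M.sumOut_mul_factorProd_compl h (dependsOn_mul (hφ.mono (by grind)) hQ)]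

lemma sumOut_joint (h : G.FrontDoorSplit X Z D E) :
    sumOut (insert X Z)ᶜ M.joint = sumOut (D \ Z) (M.factorProd D) * sumOut {X}ᶜ M.joint := by
  simpa only [one_mul, M.sumOut_factorProd_insert h.notMem_right h.ancestor] using
    M.sumOut_mul_joint h (φ := 1) fun _ _ _ => rfl

lemma sumOut_mul_factorProd_compl_singleton (h : G.FrontDoorSplit X Z D E)
    {φ : (∀ v, S v) → ℝ} (hφ : DependsOn φ ↑E) :
    sumOut (insert X Z)ᶜ (φ * M.factorProd {X}ᶜ) =
      sumOut (D \ Z) (M.factorProd D) * sumOut E (φ * M.factorProd E) := by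
  have hQ : DependsOn (M.factorProd E) ↑(insert X (E ∪ Z)) :=
    M.dependsOn_factorProd (by grind) fun hab hb =>
      Finset.mem_insert_of_mem (h.parent_right hab hb)
  have hcompl : ({X} : Finset V)ᶜ = E ∪ (insert X E)ᶜ := by
    grind [Finset.mem_compl, h.notMem_right]
  rw [hcompl, M.factorProd_union (by grind [Finset.disjoint_left, Finset.mem_compl]), ← mul_assoc,
    M.sumOut_mul_factorProd_compl h (dependsOn_mul (hφ.mono (by grind)) hQ)]

/-- The front-door formula, with `φ` in place of the indicator of the event `Y = y`. -/
theorem sumOut_mul_factorProd_eq_adjustment (h : G.FrontDoorSplit X Z D E)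
    {φ : (∀ v, S v) → ℝ} (hφ : DependsOn φ ↑E) (hne : ∀ ω, sumOut (insert X Z)ᶜ M.joint ω ≠ 0) :
    sumOut {X}ᶜ (φ * M.factorProd {X}ᶜ) =
      sumOut Z (sumOut (insert X Z)ᶜ M.joint / sumOut {X}ᶜ M.joint *
        sumOut {X} (sumOut (insert X Z)ᶜ (φ * M.joint) * sumOut {X}ᶜ M.joint /
          sumOut (insert X Z)ᶜ M.joint)) := by
  have hcompl : ({X} : Finset V)ᶜ = Z ∪ (insert X Z)ᶜ := by
    have hXZ : X ∉ Z := fun hX => h.notMem_left (h.subset hX)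
    grind [Finset.mem_compl]
  have hFK (ω) : sumOut (D \ Z) (M.factorProd D) ω ≠ 0 ∧ sumOut {X}ᶜ M.joint ω ≠ 0 := by
    rw [← mul_ne_zero_iff, ← Pi.mul_apply, ← M.sumOut_joint h]
    exact hne ω
  have hinner : sumOut (insert X Z)ᶜ (φ * M.joint) * sumOut {X}ᶜ M.joint /
      sumOut (insert X Z)ᶜ M.joint = sumOut E (φ * M.factorProd (insert X E)) := by
    funext ω
    obtain ⟨hF, hK⟩ := hFK ω
    simp only [M.sumOut_mul_joint h hφ, M.sumOut_joint h, Pi.mul_apply, Pi.div_apply]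
    field_simp
  calc sumOut {X}ᶜ (φ * M.factorProd {X}ᶜ)
      = sumOut Z (sumOut (insert X Z)ᶜ (φ * M.factorProd {X}ᶜ)) := by
        rw [sumOut_sumOut (by grind [Finset.disjoint_left, Finset.mem_compl]), ← hcompl]
    _ = sumOut Z (sumOut (D \ Z) (M.factorProd D) * sumOut E (φ * M.factorProd E)) := by
        rw [M.sumOut_mul_factorProd_compl_singleton h hφ]
    _ = _ := by
        rw [hinner, M.sumOut_sumOut_factorProd_insert h hφ, M.sumOut_joint h]
        congr 1
        funext ω
        obtain ⟨hF, hK⟩ := hFK ω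
        simp only [Pi.mul_apply, Pi.div_apply]
        field_simp

end Adjustment

end CausalModel

namespace CausalModel

section Prob

variable {V : Type*} [Fintype V] [DecidableEq V] {G : CausalDiagram V} {S : V → Type*}
  [∀ v, Fintype (S v)] (M : CausalModel G S) {p q r : (∀ v, S v) → Prop} [DecidablePred p]
  [DecidablePred q] [DecidablePred r]

/-- The probability of the event `p` under the observational distribution. -/
def prob (p : (∀ v, S v) → Prop) [DecidablePred p] : ℝ :=
  ∑ ω : (∀ v, S v), if p ω then M.joint ω else 0

lemma prob_nonneg : 0 ≤ M.prob p :=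
  Finset.sum_nonneg fun ω _ => ite_nonneg (M.joint_nonneg ω) le_rfl

lemma prob_mono (h : ∀ ω, p ω → q ω) : M.prob p ≤ M.prob q := by
  refine Finset.sum_le_sum fun ω _ => ?_
  have := M.joint_nonneg ω
  grind

lemma sum_prob {κ : Type*} [Fintype κ] (g : (∀ v, S v) → κ)
    {r : κ → (∀ v, S v) → Prop} [∀ k, DecidablePred (r k)]
    (h : ∀ k ω, r k ω ↔ p ω ∧ g ω = k) : ∑ k, M.prob (r k) = M.prob p := by
  classical
  simp only [prob, h]
  rw [Finset.sum_comm]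
  refine Finset.sum_congr rfl fun ω _ => ?_
  by_cases hp : p ω <;> simp [hp]

/-- The Fréchet lower bound. -/
lemma prob_add_prob_sub_one_le (h : ∀ ω, p ω → q ω → r ω) :
    M.prob p + M.prob q - 1 ≤ M.prob r := by
  rw [← M.sum_joint, prob, prob, prob, ← Finset.sum_add_distrib, ← Finset.sum_sub_distrib]
  refine Finset.sum_le_sum fun ω _ => ?_
  have := M.joint_nonneg ω
  grind

lemma prob_mem_Icc (hp : ∀ ω, r ω → p ω) (hq : ∀ ω, r ω → q ω) (hr : ∀ ω, p ω → q ω → r ω) :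
    M.prob r ∈ Set.Icc (max 0 (M.prob p + M.prob q - 1)) (min (M.prob p) (M.prob q)) :=
  ⟨max_le M.prob_nonneg (M.prob_add_prob_sub_one_le hr), le_min (M.prob_mono hp) (M.prob_mono hq)⟩

end Prob

section Marginals

lemma forall_notMem_compl_insert_iff {V : Type*} [Fintype V] [DecidableEq V] {S : V → Type*}
    {X : V} {W U : Finset V} {σ τ : ∀ v, S v} :
    (∀ v ∉ (insert X (W ∪ U))ᶜ, σ v = τ v) ↔
      σ X = τ X ∧ (fun v : W => σ v) = (fun v : W => τ v) ∧
        (fun v : U => σ v) = fun v : U => τ v := by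
  simp only [Finset.mem_compl, not_not, Finset.mem_insert, Finset.mem_union, or_imp, forall_and,
    forall_eq, funext_iff, Subtype.forall]

variable {V : Type*} [Fintype V] [DecidableEq V] {G : CausalDiagram V} {S : V → Type*}
  [∀ v, Fintype (S v)] [∀ v, DecidableEq (S v)] (M : CausalModel G S) (X Y : V) (W U : Finset V)
  (x : S X) (y : S Y) (w : (v : W) → S v) (u : (v : U) → S v) (ω : ∀ v, S v)

/-- The marginal `P(x, y, w, u)`, which is the true value of the variable `a` of the optimization
problem. -/
def probXYWU : ℝ :=
  M.prob fun ω => ω X = x ∧ ω Y = y ∧ (fun v : W => ω v) = w ∧ (fun v : U => ω v) = u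

lemma pxw_probXYW : FrontDoorProblem.pxw (M.probXYW X Y W) x w =
    M.prob fun ω => ω X = x ∧ (fun v : W => ω v) = w :=
  M.sum_prob (fun ω => ω Y) fun k ω => by tauto

lemma px_probXYW : FrontDoorProblem.px (M.probXYW X Y W) x = M.prob fun ω => ω X = x := by
  simp only [FrontDoorProblem.px, M.pxw_probXYW]
  exact M.sum_prob (fun ω => fun v : W => ω v) fun k ω => Iff.rfl

lemma feasible_marginals : FrontDoorProblem.Feasible (M.probXYW X Y W) (M.probU U) y
    (fun x w u => M.probXYWU X Y W U x y w u) (M.probXWU X W U) where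
  sum_a x w := M.sum_prob (fun ω => fun v : U => ω v) fun k ω => by tauto
  sum_b x w := by
    rw [M.pxw_probXYW]
    exact M.sum_prob (fun ω => fun v : U => ω v) fun k ω => by tauto
  a_le_b x w u := M.prob_mono fun ω => by tauto
  le_a x w u := (M.prob_mem_Icc (by tauto) (by tauto) (by tauto)).1
  a_le x w u := (M.prob_mem_Icc (by tauto) (by tauto) (by tauto)).2
  le_b x w u := by
    rw [M.pxw_probXYW]
    exact (M.prob_mem_Icc (by tauto) (by tauto) (by tauto)).1
  b_le x w u := by
    rw [M.pxw_probXYW]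
    exact (M.prob_mem_Icc (by tauto) (by tauto) (by tauto)).2

lemma probXWU_eq_sumOut : M.probXWU X W U (ω X) (W.restrict ω) (U.restrict ω) =
    sumOut (insert X (W ∪ U))ᶜ M.joint ω := by
  simp only [sumOut_eq_sum_ite, forall_notMem_compl_insert_iff]
  rfl

lemma probXYWU_eq_sumOut : M.probXYWU X Y W U (ω X) y (W.restrict ω) (U.restrict ω) =
    sumOut (insert X (W ∪ U))ᶜ ((fun ω => if ω Y = y then 1 else 0) * M.joint) ω := by
  simp only [sumOut_eq_sum_ite, forall_notMem_compl_insert_iff]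
  refine Finset.sum_congr rfl fun σ _ => ?_
  by_cases hy : σ Y = y <;> simp [hy, Finset.restrict_def]

lemma px_eq_sumOut : FrontDoorProblem.px (M.probXYW X Y W) (ω X) = sumOut {X}ᶜ M.joint ω := by
  simp [M.px_probXYW, prob, sumOut_eq_sum_ite]

lemma causalEffect_eq_sumOut : M.causalEffect X Y (ω X) y =
    sumOut {X}ᶜ ((fun ω => if ω Y = y then 1 else 0) * M.factorProd {X}ᶜ) ω := by
  rw [sumOut_eq_sum_ite, causalEffect]
  refine Finset.sum_congr rfl fun σ _ => ?_
  by_cases hy : σ Y = y <;> simp [hy, doJoint, factorProd, Finset.compl_singleton]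

end Marginals

section Objective

variable {V : Type*} [Fintype V] [DecidableEq V] {G : CausalDiagram V} {S : V → Type*}
  [∀ v, Fintype (S v)] [∀ v, DecidableEq (S v)] (M : CausalModel G S) {X Y : V} {W U : Finset V}

lemma objective_eq_sumOut (hWU : Disjoint W U) (hX : X ∉ W ∪ U) (y : S Y) (ω : ∀ v, S v) :
    FrontDoorProblem.objective (M.probXYW X Y W) (ω X)
      (fun x w u => M.probXYWU X Y W U x y w u) (M.probXWU X W U) =
    sumOut (W ∪ U) (sumOut (insert X (W ∪ U))ᶜ M.joint / sumOut {X}ᶜ M.joint *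
      sumOut {X} (sumOut (insert X (W ∪ U))ᶜ ((fun ω => if ω Y = y then 1 else 0) * M.joint) *
        sumOut {X}ᶜ M.joint / sumOut (insert X (W ∪ U))ᶜ M.joint)) ω := by
  rw [← funext (M.probXWU_eq_sumOut X W U), ← funext (M.probXYWU_eq_sumOut X Y W U y),
    ← funext (M.px_eq_sumOut X Y W)]
  have hinner := sumOut_singleton_restrict hX fun x w u =>
    M.probXYWU X Y W U x y w u * FrontDoorProblem.px (M.probXYW X Y W) x / M.probXWU X W U x w u
  have houter := sumOut_union_restrict hWU hX (fun x w u => M.probXWU X W U x w u /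
    FrontDoorProblem.px (M.probXYW X Y W) x * ∑ x', M.probXYWU X Y W U x' y w u *
      FrontDoorProblem.px (M.probXYW X Y W) x' / M.probXWU X W U x' w u) ω
  exact houter.symm.trans <| Finset.sum_congr rfl fun _ _ => congrArg (_ * ·) (hinner _).symm

theorem objective_eq_causalEffect (hWU : Disjoint W U)
    (hfd : G.FrontDoor X Y ((W ∪ U : Finset V) : Set V))
    (hpos : ∀ (x : S X) (w : (v : W) → S v) (u : (v : U) → S v), 0 < M.probXWU X W U x w u)
    (x : S X) (y : S Y) :
    FrontDoorProblem.objective (M.probXYW X Y W) x (fun x w u => M.probXYWU X Y W U x y w u)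
      (M.probXWU X W U) = M.causalEffect X Y x y := by
  obtain ⟨D, E, h, hYE⟩ := hfd.exists_frontDoorSplit
  have hφ : DependsOn (fun ω : (∀ v, S v) => if ω Y = y then (1 : ℝ) else 0) ↑E :=
    fun σ τ hστ => by simp only [hστ Y hYE]
  obtain ⟨ω, rfl⟩ : ∃ ω : (∀ v, S v), ω X = x :=
    ⟨Function.update (fun v => (M.nonempty_state v).some) X x, Function.update_self ..⟩
  rw [M.objective_eq_sumOut hWU hfd.left_notMem, M.causalEffect_eq_sumOut,
    M.sumOut_mul_factorProd_eq_adjustment h hφ fun σ => ?_]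
  rw [← M.probXWU_eq_sumOut]
  exact (hpos _ _ _).ne'

end Objective

end CausalModel

namespace FrontDoorProblem

lemma values_subset_Icc {α β γ δ : Type*} [Fintype α] [Fintype β] [Fintype γ] [Fintype δ]
    {pxyw : α → β → γ → ℝ} (hp : ∀ x y w, 0 ≤ pxyw x y w) (pu : δ → ℝ) (x : α) (y : β) :
    values pxyw pu x y ⊆ Set.Icc 0
      (∑ w, ∑ _u : δ, pxw pxyw x w / px pxyw x * ∑ x', px pxyw x') := by
  rintro t ⟨a, b, h, hb, rfl⟩
  have hpxw (x w) : 0 ≤ pxw pxyw x w := Finset.sum_nonneg fun y _ => hp x y w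
  have hpx (x) : 0 ≤ px pxyw x := Finset.sum_nonneg fun w _ => hpxw x w
  have ha (x w u) : 0 ≤ a x w u := (le_max_left _ _).trans (h.le_a x w u)
  have hb_pos (x w u) : 0 < b x w u :=
    lt_of_le_of_ne ((le_max_left _ _).trans (h.le_b x w u)) (hb x w u).symm
  have hinner (w u) : 0 ≤ ∑ x', a x' w u * px pxyw x' / b x' w u :=
    Finset.sum_nonneg fun x' _ => div_nonneg (mul_nonneg (ha x' w u) (hpx x')) (hb_pos x' w u).le
  constructor
  · exact Finset.sum_nonneg fun w _ => Finset.sum_nonneg fun u _ =>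
      mul_nonneg (div_nonneg (hb_pos x w u).le (hpx x)) (hinner w u)
  · unfold objective
    gcongr with w _ u _ x' _
    · exact hinner w u
    · exact div_nonneg (hpxw x w) (hpx x)
    · exact hpx x
    · exact (h.b_le x w u).trans (min_le_left _ _)
    · rw [div_le_iff₀ (hb_pos x' w u), mul_comm]
      exact mul_le_mul_of_nonneg_left (h.a_le_b x' w u) (hpx x')

end FrontDoorProblem

theorem theorem2 {V : Type*} [Fintype V] [DecidableEq V] (G : CausalDiagram V)
    {S : V → Type*} [∀ v, Fintype (S v)] [∀ v, DecidableEq (S v)] (M : CausalModel G S)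
    (X Y : V) (W U : Finset V) (hWU : Disjoint W U)
    (hfd : G.FrontDoor X Y ((W ∪ U : Finset V) : Set V))
    (hpos : ∀ (x : S X) (w : (v : W) → S v) (u : (v : U) → S v), 0 < M.probXWU X W U x w u)
    (x : S X) (y : S Y) :
    (FrontDoorProblem.values (M.probXYW X Y W) (M.probU U) x y).Nonempty ∧
    BddBelow (FrontDoorProblem.values (M.probXYW X Y W) (M.probU U) x y) ∧
    BddAbove (FrontDoorProblem.values (M.probXYW X Y W) (M.probU U) x y) ∧
    sInf (FrontDoorProblem.values (M.probXYW X Y W) (M.probU U) x y) ≤ M.causalEffect X Y x y ∧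
    M.causalEffect X Y x y ≤ sSup (FrontDoorProblem.values (M.probXYW X Y W) (M.probU U) x y) := by
  have hmem : M.causalEffect X Y x y ∈
      FrontDoorProblem.values (M.probXYW X Y W) (M.probU U) x y :=
    ⟨_, _, M.feasible_marginals X Y W U y, fun x w u => (hpos x w u).ne',
      M.objective_eq_causalEffect hWU hfd hpos x y⟩
  have hsub := FrontDoorProblem.values_subset_Icc (pxyw := M.probXYW X Y W)
    (fun x y w => M.prob_nonneg) (M.probU U) x y
  have hbelow := bddBelow_Icc.mono hsub
  have habove := bddAbove_Icc.mono hsub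
  exact ⟨⟨_, hmem⟩, hbelow, habove, csInf_le hbelow hmem, le_csSup habove hmem⟩
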